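/- In the semi-random graph process on the vertex set $[n]$ ($n\ge 2$), the player starts from the empty graph $G_0$. In each step $t\ge 1$ a vertex $u_t$ is drawn uniformly at random from $[n]$, independently of the past. The player then chooses a vertex $v_t\neq u_t$, possibly at random, with a distribution depending on $t$, on the current multigraph $G_{t-1}$ and on $u_t$. The edge $u_tv_t$ is added to $G_{t-1}$ to form the multigraph $G_t=G_t^{\mathcal S}$, where $\mathcal S$ is the player's strategy. Let $T_{\mathcal S}$ be the least $t\ge 1$ such that $G_t^{\mathcal S}$ has a given monotone property $\mathcal P$ ($T_{\mathcal S}=\infty$ if there is none). A function $m(n)$ is a sharp threshold for $\mathcal P$ if for every $\varepsilon>0$ there are strategies $\mathcal S_n$ with $\Pr(T_{\mathcal S_n}\le(1+\varepsilon)m(n))\to 1$ as $n\to\infty$, while all strategies $\mathcal S_n$ satisfy $\Pr(T_{\mathcal S_n}\le(1-\varepsilon)m(n))\to 0$. The degeneracy of a finite graph is the least $k$ such that each of its nonempty induced subgraphs has a vertex of degree at most $k$. **Theorem.** Let $L$ be a fixed nonempty finite list of fixed finite simple graphs, none of which is a forest. Let $d$ be the minimum degeneracy of the graphs in $L$, and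 let $\mathcal P$ be the property of containing at least one graph of $L$ as a (not necessarily induced) subgraph. 1. There is a constant $\alpha>0$ such that for every $n\ge 2$ and every strategy $\mathcal S$ on $[n]$, $$\Pr\bigl(G^{\mathcal S}_{\lfloor\alpha n^{(d-1)/d}\rfloor}\in\mathcal P\bigr)\le \tfrac12 .$$ 2. For every constant $\beta>0$ there is a constant $\delta=\delta(\beta)>0$ such that for all sufficiently large $n$ there is a strategy $\mathcal S$ on $[n]$ with $$\Pr\bigl(G^{\mathcal S}_{\lfloor\beta n^{(d-1)/d}\rfloor}\in\mathcal P\bigr)\ge\delta .$$ 3. Consequently, $\mathcal P$ has no sharp threshold in the semi-random graph process. -/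

import Mathlib

namespace SemiRandom

/-- A finite graph is `k`-degenerate if every nonempty induced subgraph has a vertex of degree at
most `k` in that subgraph. -/
def IsDegenerate {V : Type*} (G : SimpleGraph V) (k : ℕ) : Prop :=
  ∀ s : Set V, s.Nonempty → ∃ v ∈ s, (G.neighborSet v ∩ s).ncard ≤ k

/-- The degeneracy of a finite graph: the least `k` for which it is `k`-degenerate. -/
noncomputable def degeneracy {V : Type*} (G : SimpleGraph V) : ℕ :=
  sInf {k : ℕ | IsDegenerate G k}

/-- A multigraph on the vertex set `Fin n`, given by its multiset of edges. The process below never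
creates loops. -/
abbrev Multigraph (n : ℕ) : Type := Multiset (Sym2 (Fin n))

/-- The simple graph underlying a multigraph. -/
def Multigraph.toSimpleGraph {n : ℕ} (G : Multigraph n) : SimpleGraph (Fin n) :=
  SimpleGraph.fromEdgeSet {e | e ∈ G}

/-- A (possibly randomised) strategy for the semi-random graph process on `Fin n`. For a number `t`
of completed steps, the current multigraph `G` and the square `u` that is offered next, it gives the
distribution of the circle, which is a vertex different from `u`. -/
abbrev Strategy (n : ℕ) : Type :=
  ℕ → Multigraph n → (u : Fin n) → PMF {v : Fin n // v ≠ u}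

/-- The joint law of the edges added in the first `t` steps when the strategy `S` is played from the
empty graph. They are listed with the newest edge first. In every step the square `u` is uniform on
`Fin n` and independent of the past, the circle `v` is drawn according to `S`, and the edge `uv` is
added. -/
noncomputable def edgeLaw {n : ℕ} [NeZero n] (S : Strategy n) : ℕ → PMF (List (Sym2 (Fin n)))
  | 0 => PMF.pure []
  | t + 1 => (edgeLaw S t).bind fun l =>
      (PMF.uniformOfFintype (Fin n)).bind fun u =>
        (S t (l : Multigraph n) u).map fun v => s(u, v.1) :: l

/-- The probability that the multigraph `G_t` present after `t` steps of `S` satisfies `P`. -/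
noncomputable def probAt {n : ℕ} [NeZero n] (S : Strategy n) (P : Multigraph n → Prop) (t : ℕ) :
    ℝ :=
  ((edgeLaw S t).toOuterMeasure {l | P (l : Multigraph n)}).toReal

/-- The probability that `T ≤ x`, where `T` is the least `t ≥ 1` such that `G_t` satisfies `P`
(and `T = ∞` if there is none). The multigraphs `G_1, …, G_k` for `k = ⌊x⌋` are given by the
nonempty suffixes of the list of the first `k` edges. -/
noncomputable def probHit {n : ℕ} [NeZero n] (S : Strategy n) (P : Multigraph n → Prop) (x : ℝ) :
    ℝ :=
  ((edgeLaw S ⌊x⌋₊).toOuterMeasure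
    {l | ∃ l' : List (Sym2 (Fin n)), l' ≠ [] ∧ l' <:+ l ∧ P (l' : Multigraph n)}).toReal

/-- The function `st` is a sharp threshold of the property `P` in the semi-random graph process.
The strategies form a sequence over the numbers `n + 2` of vertices, since no edge can be added to a
graph with fewer than two vertices. -/
def IsSharpThreshold (P : ∀ n : ℕ, Multigraph n → Prop) (st : ℕ → ℝ) : Prop :=
  ∀ ε : ℝ, 0 < ε →
    (∃ S : ∀ n : ℕ, Strategy (n + 2),
      Filter.Tendsto (fun n : ℕ => probHit (S n) (P (n + 2)) ((1 + ε) * st (n + 2)))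
        Filter.atTop (nhds 1)) ∧
    (∀ S : ∀ n : ℕ, Strategy (n + 2),
      Filter.Tendsto (fun n : ℕ => probHit (S n) (P (n + 2)) ((1 - ε) * st (n + 2)))
        Filter.atTop (nhds 0))

/-- The property of containing a copy of at least one graph of the family `H` as a (not necessarily
induced) subgraph. -/
def ContainsSome {ι : Type*} {V : ι → Type*} (H : ∀ i, SimpleGraph (V i)) (n : ℕ)
    (G : Multigraph n) : Prop :=
  ∃ i, (H i).IsContained (Multigraph.toSimpleGraph G)

end SemiRandom

/-! Lower bound. Orient each edge from its square to its circle; the square is uniform whatever the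
player does. A copy of a graph of degeneracy at least `d` contains a set `K` of boundedly many
vertices, at most `s`, inside which all degrees are at least `d`. Give vertices ranks relative to
`K`: the square of an edge inside `K` gains one and passes its new rank on to everything it reaches
inside `K`. Ranks never fall along edges, and peeling off edges backwards in time
(`exists_degreeIn_le`) shows that if all ranks in `K` are below `d`, some vertex has degree below
`d` in `K`. So rank `d` must occur. A new vertex of rank `j + 1` needs a square of rank at least
`j`, and while out-degrees stay below `d` at most `B = d ^ s` vertices gain at once. Inductively the
expected number of vertices of rank at least `j` after `t` steps is at most `n (B t / n) ^ j`
(`expect_card_le`); for `j = d` and `t = α n ^ ((d - 1) / d)` this is at most `(B α) ^ d`.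
Out-degree `d` is excluded in the same way with `B = 1`.

Upper bound. Build a graph of minimum degeneracy in a degenerate order, each vertex having at most
`d` earlier neighbours. With `x = n ^ (1 / d)`, a round of order `x ^ (d - 1)` steps spent on one
earlier neighbour keeps a fraction of order `1 / x` of the candidates. After `d - 1` rounds about
`x` candidates remain, and the last round hits one of them with probability bounded below
(`le_valueSet_attach`).

A sharp threshold is impossible because changing the constant in front of `n ^ ((d - 1) / d)` never
forces the probability to 0. -/

namespace SemiRandom

open scoped ENNReal

/-! ### Expectations of nonnegative functions -/

section Expectation

variable {α β : Type*}

/-- The expectation of a nonnegative function under a probability mass function. -/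
noncomputable def expect (p : PMF α) (f : α → ℝ≥0∞) : ℝ≥0∞ := ∑' a, p a * f a

theorem expect_pure (a : α) (f : α → ℝ≥0∞) : expect (PMF.pure a) f = f a := by
  rw [expect, tsum_eq_single a]
  · simp
  · intro b hb
    simp [hb]

theorem expect_bind (p : PMF α) (q : α → PMF β) (f : β → ℝ≥0∞) :
    expect (p.bind q) f = expect p fun a => expect (q a) f := by
  simp only [expect, PMF.bind_apply, ← ENNReal.tsum_mul_right, ← ENNReal.tsum_mul_left]
  rw [ENNReal.tsum_comm]
  simp only [mul_assoc]

theorem expect_map (p : PMF α) (g : α → β) (f : β → ℝ≥0∞) :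
    expect (p.map g) f = expect p (f ∘ g) := by
  rw [← PMF.bind_pure_comp, expect_bind]
  simp [expect_pure, Function.comp_def]

theorem expect_mono (p : PMF α) {f g : α → ℝ≥0∞} (h : ∀ a, f a ≤ g a) :
    expect p f ≤ expect p g :=
  ENNReal.tsum_le_tsum fun a => mul_le_mul_right (h a) _

theorem expect_const (p : PMF α) (c : ℝ≥0∞) : expect p (fun _ => c) = c := by
  rw [expect, ENNReal.tsum_mul_right, p.tsum_coe, one_mul]

theorem expect_add (p : PMF α) (f g : α → ℝ≥0∞) :
    expect p (fun a => f a + g a) = expect p f + expect p g := by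
  simp only [expect, mul_add, ENNReal.tsum_add]

theorem expect_const_mul (p : PMF α) (c : ℝ≥0∞) (f : α → ℝ≥0∞) :
    expect p (fun a => c * f a) = c * expect p f := by
  simp only [expect, ← ENNReal.tsum_mul_left]
  exact tsum_congr fun a => by ring

theorem expect_uniformOfFintype {n : ℕ} [NeZero n] (f : Fin n → ℝ≥0∞) :
    expect (PMF.uniformOfFintype (Fin n)) f = (n : ℝ≥0∞)⁻¹ * ∑ u, f u := by
  simp [expect, tsum_fintype, Finset.mul_sum]

theorem toOuterMeasure_eq_expect (p : PMF α) (s : Set α) :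
    p.toOuterMeasure s = expect p (s.indicator 1) := by
  rw [PMF.toOuterMeasure_apply, expect]
  refine tsum_congr fun a => ?_
  by_cases h : a ∈ s <;> simp [h]

/-- Markov's inequality. -/
theorem toOuterMeasure_le_expect (p : PMF α) {s : Set α} {f : α → ℝ≥0∞}
    (h : ∀ a ∈ s, 1 ≤ f a) : p.toOuterMeasure s ≤ expect p f := by
  rw [toOuterMeasure_eq_expect]
  refine expect_mono p fun a => ?_
  by_cases ha : a ∈ s
  · simpa [ha] using h a ha
  · simp [ha]

theorem toOuterMeasure_ne_top (p : PMF α) (s : Set α) : p.toOuterMeasure s ≠ ⊤ := by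
  refine ne_top_of_le_ne_top ENNReal.one_ne_top
    ((toOuterMeasure_le_expect p (f := fun _ => 1) fun _ _ => le_rfl).trans ?_)
  rw [expect_const]

end Expectation

/-! ### The process with oriented edges -/

section Law

variable {n : ℕ} [NeZero n]

/-- The unoriented edges of a list of pairs of a square and a circle. -/
abbrev edges (l : List (Fin n × Fin n)) : List (Sym2 (Fin n)) := l.map fun p => s(p.1, p.2)

/-- The joint law of the pairs of a square and a circle in the first `t` steps, the newest pair
first. -/
noncomputable def pairLaw (S : Strategy n) : ℕ → PMF (List (Fin n × Fin n))
  | 0 => PMF.pure []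
  | t + 1 => (pairLaw S t).bind fun l =>
      (PMF.uniformOfFintype (Fin n)).bind fun u =>
        (S t (edges l : Multigraph n) u).map fun v => (u, v.1) :: l

theorem edgeLaw_eq_map_pairLaw (S : Strategy n) (t : ℕ) :
    edgeLaw S t = (pairLaw S t).map edges := by
  induction t with
  | zero => simp [edgeLaw, pairLaw, PMF.pure_map]
  | succ t ih =>
    simp only [edgeLaw, pairLaw, ih, PMF.bind_map, PMF.map_bind, PMF.map_comp]
    rfl

theorem expect_pairLaw_succ (S : Strategy n) (t : ℕ) (f : List (Fin n × Fin n) → ℝ≥0∞) :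
    expect (pairLaw S (t + 1)) f = expect (pairLaw S t) fun l => (n : ℝ≥0∞)⁻¹ * ∑ u,
      expect (S t (edges l : Multigraph n) u) fun v => f ((u, v.1) :: l) := by
  rw [pairLaw, expect_bind]
  congr 1
  funext l
  rw [expect_bind, expect_uniformOfFintype]
  simp only [expect_map]
  rfl

theorem expect_edgeLaw_succ (S : Strategy n) (t : ℕ) (f : List (Sym2 (Fin n)) → ℝ≥0∞) :
    expect (edgeLaw S (t + 1)) f = expect (edgeLaw S t) fun l => (n : ℝ≥0∞)⁻¹ * ∑ u,
      expect (S t (l : Multigraph n) u) fun v => f (s(u, v.1) :: l) := by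
  rw [edgeLaw, expect_bind]
  congr 1
  funext l
  rw [expect_bind, expect_uniformOfFintype]
  simp only [expect_map]
  rfl

theorem average_const (c : ℝ≥0∞) : (n : ℝ≥0∞)⁻¹ * ∑ _u : Fin n, c = c := by
  rw [Finset.sum_const, Finset.card_univ, Fintype.card_fin, nsmul_eq_mul, ← mul_assoc,
    ENNReal.inv_mul_cancel (by exact_mod_cast NeZero.ne n) (by simp), one_mul]

/-- Monotone properties become more likely with time. -/
theorem probAt_mono (S : Strategy n) {P : Multigraph n → Prop}
    (hP : ∀ G G' : Multigraph n, G ≤ G' → P G → P G') {t t' : ℕ} (h : t ≤ t') :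
    probAt S P t ≤ probAt S P t' := by
  refine monotone_nat_of_le_succ (f := probAt S P) (fun t => ?_) h
  refine ENNReal.toReal_mono (toOuterMeasure_ne_top _ _) ?_
  rw [toOuterMeasure_eq_expect, toOuterMeasure_eq_expect, expect_edgeLaw_succ]
  refine expect_mono _ fun l => ?_
  by_cases hl : P (l : Multigraph n)
  · have h1 : ∀ e : Sym2 (Fin n), P ((e :: l : List (Sym2 (Fin n))) : Multigraph n) := fun e =>
      hP _ _ (by rw [← Multiset.cons_coe]; exact Multiset.le_cons_self _ _) hl
    simp [Set.indicator, hl, h1, expect_const, ENNReal.inv_mul_cancel, NeZero.ne n]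
  · simp [Set.indicator, hl]

/-- For a monotone property that the empty graph lacks, the hitting time is at most `x` if and only
if the property holds after `⌊x⌋` steps. -/
theorem probHit_eq_probAt (S : Strategy n) {P : Multigraph n → Prop}
    (hP : ∀ G G' : Multigraph n, G ≤ G' → P G → P G') (h0 : ¬ P 0) (x : ℝ) :
    probHit S P x = probAt S P ⌊x⌋₊ := by
  have : {l : List (Sym2 (Fin n)) | ∃ l' : List (Sym2 (Fin n)),
      l' ≠ [] ∧ l' <:+ l ∧ P (l' : Multigraph n)} =
      {l : List (Sym2 (Fin n)) | P (l : Multigraph n)} := by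
    ext l
    constructor
    · rintro ⟨l', -, hl, h⟩
      exact hP _ _ (Multiset.coe_le.2 hl.sublist.subperm) h
    · intro h
      refine ⟨l, ?_, List.suffix_rfl, h⟩
      rintro rfl
      exact h0 h
  rw [probHit, probAt, this]

end Law

/-! ### The value of the game -/

section Value

variable {n : ℕ}

/-- The largest expected payoff after one further step. -/
noncomputable def step (g : Multigraph n → ℝ≥0∞) (G : Multigraph n) : ℝ≥0∞ :=
  (n : ℝ≥0∞)⁻¹ * ∑ u, ⨆ v : {v : Fin n // v ≠ u}, g (s(u, v.1) ::ₘ G)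

/-- The largest expected payoff after `r` further steps. -/
noncomputable def value (g : Multigraph n → ℝ≥0∞) (r : ℕ) : Multigraph n → ℝ≥0∞ := step^[r] g

theorem value_zero (g : Multigraph n → ℝ≥0∞) : value g 0 = g := rfl

theorem value_succ (g : Multigraph n → ℝ≥0∞) (r : ℕ) : value g (r + 1) = step (value g r) :=
  Function.iterate_succ_apply' _ _ _

theorem value_add (g : Multigraph n → ℝ≥0∞) (r r' : ℕ) :
    value g (r + r') = value (value g r') r :=
  Function.iterate_add_apply _ _ _ _

theorem value_le_value {g g' : Multigraph n → ℝ≥0∞} (r : ℕ) {G : Multigraph n}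
    (h : ∀ G', G ≤ G' → g G' ≤ g' G') : value g r G ≤ value g' r G := by
  induction r generalizing G with
  | zero => exact h G le_rfl
  | succ r ih =>
    rw [value_succ, value_succ]
    refine mul_le_mul_right (Finset.sum_le_sum fun u _ => iSup_mono fun v => ?_) _
    exact ih fun G' hG' => h G' ((Multiset.le_cons_self _ _).trans hG')

theorem value_const_mul (c : ℝ≥0∞) (g : Multigraph n → ℝ≥0∞) (r : ℕ) (G : Multigraph n) :
    value (fun G => c * g G) r G = c * value g r G := by
  induction r generalizing G with
  | zero => rfl
  | succ r ih =>
    have : value (fun G => c * g G) r = fun G => c * value g r G := funext ih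
    rw [value_succ, value_succ, this]
    simp only [step, ← ENNReal.mul_iSup, ← Finset.mul_sum]
    ring

/-- The largest probability of being in `𝒢` after `r` further steps. -/
noncomputable abbrev valueSet (𝒢 : Set (Multigraph n)) (r : ℕ) : Multigraph n → ℝ≥0∞ :=
  value (𝒢.indicator 1) r

theorem valueSet_succ (𝒢 : Set (Multigraph n)) (r : ℕ) (G : Multigraph n) :
    valueSet 𝒢 (r + 1) G = (n : ℝ≥0∞)⁻¹ *
      ∑ u, ⨆ v : {v : Fin n // v ≠ u}, valueSet 𝒢 r (s(u, v.1) ::ₘ G) := by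
  rw [valueSet, value_succ, step]

/-- Phases of play are chained here: since `q` is a bound from every outcome of the first phase, the
success probabilities multiply without any independence argument. -/
theorem mul_le_valueSet_add {𝒢 𝒢' : Set (Multigraph n)} {G : Multigraph n} {p q : ℝ≥0∞}
    {r r' : ℕ} (hp : p ≤ valueSet 𝒢 r G) (hq : ∀ G' ∈ 𝒢, G ≤ G' → q ≤ valueSet 𝒢' r' G') :
    p * q ≤ valueSet 𝒢' (r + r') G := by
  rw [valueSet, value_add]
  calc p * q ≤ q * valueSet 𝒢 r G := by rw [mul_comm]; gcongr
    _ = value (fun G => q * 𝒢.indicator 1 G) r G := (value_const_mul _ _ _ _).symm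
    _ ≤ _ := value_le_value r fun G' hG' => by
      by_cases h : G' ∈ 𝒢
      · simpa [h] using hq G' h hG'
      · simp [h]

theorem valueSet_mono_left {𝒢 𝒢' : Set (Multigraph n)} (r : ℕ) {G : Multigraph n}
    (h : ∀ G' ∈ 𝒢, G ≤ G' → G' ∈ 𝒢') : valueSet 𝒢 r G ≤ valueSet 𝒢' r G :=
  value_le_value r fun G' hG' => by
    by_cases hG : G' ∈ 𝒢
    · simp [hG, h G' hG hG']
    · simp [hG]

theorem nonempty_circle (hn : 2 ≤ n) (u : Fin n) : Nonempty {v : Fin n // v ≠ u} := by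
  have : Nontrivial (Fin n) := Fin.nontrivial_iff_two_le.2 hn
  exact nonempty_subtype.2 (exists_ne u)

variable [NeZero n]

theorem value_one (hn : 2 ≤ n) (r : ℕ) (G : Multigraph n) : value (fun _ => 1) r G = 1 := by
  induction r generalizing G with
  | zero => rfl
  | succ r ih =>
    have : value (fun _ : Multigraph n => 1) r = fun _ => 1 := funext ih
    have := nonempty_circle hn
    rw [value_succ, ‹value _ _ = _›]
    simp only [step, ciSup_const]
    exact average_const 1

theorem one_le_valueSet (hn : 2 ≤ n) {𝒢 : Set (Multigraph n)} {G : Multigraph n}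
    (h : ∀ G', G ≤ G' → G' ∈ 𝒢) (r : ℕ) : 1 ≤ valueSet 𝒢 r G := by
  rw [← value_one hn r G]
  exact value_le_value r fun G' hG' => by simp [h G' hG']

theorem valueSet_mono_right (hn : 2 ≤ n) {𝒢 : Set (Multigraph n)} (h𝒢 : IsUpperSet 𝒢) {r r' : ℕ}
    (h : r ≤ r') (G : Multigraph n) : valueSet 𝒢 r G ≤ valueSet 𝒢 r' G := by
  obtain ⟨k, rfl⟩ := Nat.exists_eq_add_of_le h
  rw [← mul_one (valueSet 𝒢 r G)]
  exact mul_le_valueSet_add le_rfl fun G' hG' _ => one_le_valueSet hn (fun _ h => h𝒢 h hG') k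

/-- If the player can make a potential decrease by the factor `x` on average in each step as long as
the target is not reached, then the target is missed with probability at most `x ^ r` times the
initial potential. -/
theorem one_le_valueSet_add (hn : 2 ≤ n) {𝒢 : Set (Multigraph n)} (h𝒢 : IsUpperSet 𝒢)
    (e : Multigraph n → ℝ≥0∞) (x : ℝ≥0∞) (c : ∀ u : Fin n, {v // v ≠ u})
    (h0 : ∀ G ∉ 𝒢, 1 ≤ e G)
    (hx : ∀ G ∉ 𝒢, (n : ℝ≥0∞)⁻¹ * ∑ u, e (s(u, (c u).1) ::ₘ G) ≤ x * e G) (r : ℕ)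
    (G : Multigraph n) : 1 ≤ valueSet 𝒢 r G + x ^ r * e G := by
  induction r generalizing G with
  | zero =>
    by_cases hG : G ∈ 𝒢
    · simp [value_zero, hG]
    · simpa [value_zero, hG] using h0 G hG
  | succ r ih =>
    by_cases hG : G ∈ 𝒢
    · exact (one_le_valueSet hn (fun _ h => h𝒢 h hG) _).trans le_self_add
    calc 1 = (n : ℝ≥0∞)⁻¹ * ∑ _u : Fin n, 1 := (average_const 1).symm
      _ ≤ (n : ℝ≥0∞)⁻¹ * ∑ u : Fin n, ((⨆ v : {v : Fin n // v ≠ u},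
            valueSet 𝒢 r (s(u, v.1) ::ₘ G)) + x ^ r * e (s(u, (c u).1) ::ₘ G)) := by
          gcongr with u
          exact (ih _).trans (add_le_add_left
            (le_iSup (fun v : {v : Fin n // v ≠ u} => valueSet 𝒢 r (s(u, v.1) ::ₘ G)) (c u)) _)
      _ = valueSet 𝒢 (r + 1) G +
            x ^ r * ((n : ℝ≥0∞)⁻¹ * ∑ u, e (s(u, (c u).1) ::ₘ G)) := by
          rw [Finset.sum_add_distrib, mul_add, ← Finset.mul_sum, valueSet_succ]
          ring
      _ ≤ valueSet 𝒢 (r + 1) G + x ^ r * (x * e G) := by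
          exact add_le_add_right (mul_le_mul_right (hx G hG) _) _
      _ = _ := by ring

/-- The value of the game is attained by a strategy. -/
theorem exists_strategy_valueSet_le (hn : 2 ≤ n) (P : Multigraph n → Prop) (r : ℕ) :
    ∃ S : Strategy n, valueSet {G | P G} r 0 ≤ ENNReal.ofReal (probAt S P r) := by
  have := nonempty_circle hn
  -- There are finitely many circles, so an optimal one exists; playing it deterministically keeps
  -- the expected remaining value constant.
  have hmax : ∀ (t : ℕ) (G : Multigraph n) (u : Fin n), ∃ v : {v : Fin n // v ≠ u},
      valueSet {G | P G} (r - (t + 1)) (s(u, v.1) ::ₘ G) =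
        ⨆ v : {v : Fin n // v ≠ u}, valueSet {G | P G} (r - (t + 1)) (s(u, v.1) ::ₘ G) :=
    fun t G u => exists_eq_ciSup_of_finite
  choose c hc using hmax
  let S : Strategy n := fun t G u => PMF.pure (c t G u)
  have key : ∀ t ≤ r, expect (edgeLaw S t) (fun l => valueSet {G | P G} (r - t) (l : Multigraph n))
      = valueSet {G | P G} r 0 := by
    intro t
    induction t with
    | zero =>
      intro _
      simp [edgeLaw, expect_pure]
    | succ t ih =>
      intro ht
      rw [← ih (by lia), expect_edgeLaw_succ]
      congr 1
      funext l
      have h1 : r - t = r - (t + 1) + 1 := by lia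
      rw [h1, valueSet_succ]
      simp only [S, expect_pure, ← Multiset.cons_coe, hc]
  refine ⟨S, ?_⟩
  rw [probAt, ENNReal.ofReal_toReal (toOuterMeasure_ne_top _ _), toOuterMeasure_eq_expect,
    ← key r le_rfl]
  refine expect_mono _ fun l => ?_
  simp [value_zero, Set.indicator]

end Value

/-! ### Reachability and ranks -/

section Rank

variable {α : Type*} [DecidableEq α]

/-- The vertices that are reachable from `u` by at most `k` of the oriented edges in `l`. -/
def reachSet (l : List (α × α)) (u : α) : ℕ → Finset α
  | 0 => {u}
  | k + 1 => reachSet l u k ∪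
      (reachSet l u k).biUnion fun y => ((l.filter fun p => p.1 = y).map Prod.snd).toFinset

theorem mem_reachSet_succ {l : List (α × α)} {u x : α} {k : ℕ} :
    x ∈ reachSet l u (k + 1) ↔ x ∈ reachSet l u k ∨ ∃ y ∈ reachSet l u k, (y, x) ∈ l := by
  simp [reachSet]

theorem reachSet_mono (l : List (α × α)) (u : α) : Monotone (reachSet l u) :=
  monotone_nat_of_le_succ fun _ => Finset.subset_union_left

theorem self_mem_reachSet (l : List (α × α)) (u : α) (k : ℕ) : u ∈ reachSet l u k :=
  reachSet_mono l u (Nat.zero_le k) (Finset.mem_singleton_self u)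

/-- The number of steps in which `x` is the square. -/
abbrev outDegree (l : List (α × α)) (x : α) : ℕ := l.countP fun p => p.1 = x

theorem card_reachSet_le {l : List (α × α)} {Δ : ℕ} (h : ∀ x, outDegree l x ≤ Δ) (u : α) (k : ℕ) :
    (reachSet l u k).card ≤ (Δ + 1) ^ k := by
  induction k with
  | zero => simp [reachSet]
  | succ k ih =>
    have h1 : ∀ y ∈ reachSet l u k,
        ((l.filter fun p => p.1 = y).map Prod.snd).toFinset.card ≤ Δ := fun y _ =>
      (List.toFinset_card_le _).trans (by
        rw [List.length_map, ← List.countP_eq_length_filter]; exact h y)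
    calc (reachSet l u (k + 1)).card ≤ (reachSet l u k).card + (reachSet l u k).card * Δ :=
          (Finset.card_union_le _ _).trans
            (Nat.add_le_add_left (Finset.card_biUnion_le_card_mul _ _ _ h1) _)
      _ = (reachSet l u k).card * (Δ + 1) := by ring
      _ ≤ _ := by rw [pow_succ]; gcongr

/-- The oriented edges of `l` with both ends in `K`. -/
def restrict (l : List (α × α)) (K : Finset α) : List (α × α) :=
  l.filter fun p => p.1 ∈ K ∧ p.2 ∈ K

theorem mem_restrict {l : List (α × α)} {K : Finset α} {x y : α} :
    (x, y) ∈ restrict l K ↔ (x, y) ∈ l ∧ x ∈ K ∧ y ∈ K := by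
  simp [restrict]

/-- This removes the dependence on `K`: the vertices affected by an update lie in one set that
serves all `K` at once. -/
theorem reachSet_restrict_subset (l : List (α × α)) (K : Finset α) (u : α) (k : ℕ) :
    reachSet (restrict l K) u k ⊆ reachSet l u k := by
  induction k with
  | zero => rfl
  | succ k ih =>
    intro x hx
    rw [mem_reachSet_succ] at hx ⊢
    rcases hx with hx | ⟨y, hy, hyx⟩
    · exact Or.inl (ih hx)
    · exact Or.inr ⟨y, ih hy, (mem_restrict.1 hyx).1⟩

theorem reachSet_restrict_subset_self (l : List (α × α)) {K : Finset α} {u : α} (hu : u ∈ K)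
    (k : ℕ) : reachSet (restrict l K) u k ⊆ K := by
  induction k with
  | zero => simpa [reachSet] using hu
  | succ k ih =>
    intro x hx
    rw [mem_reachSet_succ] at hx
    rcases hx with hx | ⟨y, -, hyx⟩
    · exact ih hx
    · exact (mem_restrict.1 hyx).2.2

theorem card_reachSet_ge (l : List (α × α)) (u : α) (k : ℕ)
    (h : ∀ i < k, ∃ y ∈ reachSet l u i, ∃ x ∉ reachSet l u i, (y, x) ∈ l) :
    k + 1 ≤ (reachSet l u k).card := by
  induction k with
  | zero => simp [reachSet]
  | succ k ih =>
    obtain ⟨y, hy, x, hx, hyx⟩ := h k k.lt_succ_self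
    have : reachSet l u k ⊂ reachSet l u (k + 1) :=
      (Finset.ssubset_iff_of_subset (reachSet_mono l u k.le_succ)).2
        ⟨x, mem_reachSet_succ.2 (Or.inr ⟨y, hy, hyx⟩), hx⟩
    have := Finset.card_lt_card this
    have := ih fun i hi => h i (by lia)
    lia

theorem reachSet_closed_of_le {l : List (α × α)} {u : α} {i : ℕ}
    (h : ∀ y ∈ reachSet l u i, ∀ x, (y, x) ∈ l → x ∈ reachSet l u i) (k : ℕ) :
    reachSet l u (i + k) = reachSet l u i := by
  induction k with
  | zero => rfl
  | succ k ih =>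
    ext x
    rw [← add_assoc, mem_reachSet_succ, ih]
    exact ⟨fun hx => hx.elim id fun ⟨y, hy, hyx⟩ => h y hy x hyx, Or.inl⟩

/-- Within a set of at most `s` vertices, reachability by `s` edges is closed under edges. -/
theorem mem_reachSet_of_edge {l : List (α × α)} {K : Finset α} {s : ℕ} (hK : K.card ≤ s) {u x y : α}
    (hu : u ∈ K) (hy : y ∈ reachSet (restrict l K) u s) (hyx : (y, x) ∈ restrict l K) :
    x ∈ reachSet (restrict l K) u s := by
  -- Strict growth in each of `s` rounds would give `s + 1` vertices inside `K`, so the reachable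
  -- set stabilises before round `s`.
  have hex : ∃ i < s, ∀ y ∈ reachSet (restrict l K) u i, ∀ x, (y, x) ∈ restrict l K →
      x ∈ reachSet (restrict l K) u i := by
    by_contra! hcon
    have h1 := card_reachSet_ge (restrict l K) u s fun i hi => by
      obtain ⟨y, hy, x, hyx, hx⟩ := hcon i hi
      exact ⟨y, hy, x, hx, hyx⟩
    have h2 := Finset.card_le_card (reachSet_restrict_subset_self l hu s)
    lia
  obtain ⟨i, hi, hcl⟩ := hex
  obtain ⟨k, rfl⟩ := Nat.exists_eq_add_of_lt hi
  rw [add_assoc, reachSet_closed_of_le hcl] at hy ⊢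
  exact hcl y hy x hyx

/-- The rank of a vertex with respect to a vertex set `K`. Whenever an edge with square `u` is added
within `K`, the rank of `u` increases by one, and ranks are propagated along the oriented edges
within `K`. -/
def rank (s : ℕ) (K : Finset α) : List (α × α) → α → ℕ
  | [], _ => 0
  | p :: l, x =>
    if p.1 ∈ K ∧ p.2 ∈ K ∧ x ∈ reachSet (restrict (p :: l) K) p.1 s then
      max (rank s K l x) (rank s K l p.1 + 1)
    else rank s K l x

theorem rank_le_rank_cons (s : ℕ) (K : Finset α) (p : α × α) (l : List (α × α)) (x : α) :
    rank s K l x ≤ rank s K (p :: l) x := by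
  rw [rank]
  split_ifs
  · exact le_max_left _ _
  · exact le_rfl

/-- An update raises a set closed under edges in `K`, so if it touches the tail it touches the head.
An edge is itself covered by the update at its arrival. -/
theorem rank_le_rank_of_edge {s : ℕ} {K : Finset α} (hK : K.card ≤ s) {l : List (α × α)} {x y : α}
    (h : (y, x) ∈ restrict l K) : rank s K l y ≤ rank s K l x := by
  induction l with
  | nil => simp [restrict] at h
  | cons p l ih =>
    by_cases hy : p.1 ∈ K ∧ p.2 ∈ K ∧ y ∈ reachSet (restrict (p :: l) K) p.1 s
    · have hx : p.1 ∈ K ∧ p.2 ∈ K ∧ x ∈ reachSet (restrict (p :: l) K) p.1 s :=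
        ⟨hy.1, hy.2.1, mem_reachSet_of_edge hK hy.1 hy.2.2 h⟩
      rw [rank, rank, if_pos hy, if_pos hx]
      obtain ⟨hm, hyK, hxK⟩ := mem_restrict.1 h
      rcases List.mem_cons.1 hm with rfl | hm
      · simp
      · exact max_le_max (ih (mem_restrict.2 ⟨hm, hyK, hxK⟩)) le_rfl
    · obtain ⟨hm, hyK, hxK⟩ := mem_restrict.1 h
      have hm : (y, x) ∈ l := by
        refine (List.mem_cons.1 hm).resolve_left ?_
        rintro rfl
        exact hy ⟨hyK, hxK, self_mem_reachSet _ _ _⟩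
      refine le_trans ?_ (rank_le_rank_cons s K p l x)
      rw [rank, if_neg hy]
      exact ih (mem_restrict.2 ⟨hm, hyK, hxK⟩)

/-- The number of edges in `l` from `x` into `K` or from `C` into `x`. -/
abbrev degreeIn (l : List (α × α)) (K C : Finset α) (x : α) : ℕ :=
  l.countP fun p => (p.1 = x ∧ p.2 ∈ K) ∨ (p.2 = x ∧ p.1 ∈ C)

/-- A set of vertices of rank at most `j` has a vertex of degree at most `j`. -/
theorem exists_degreeIn_le {s : ℕ} {K : Finset α} (hK : K.card ≤ s) (l : List (α × α)) {j : ℕ}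
    {C : Finset α} (hCK : C ⊆ K) (hC : C.Nonempty) (hr : ∀ x ∈ C, rank s K l x ≤ j) :
    ∃ x ∈ C, degreeIn l K C x ≤ j := by
  induction l generalizing j C with
  | nil =>
    obtain ⟨x, hx⟩ := hC
    exact ⟨x, hx, by simp⟩
  | cons p l ih =>
    have hr' : ∀ x ∈ C, rank s K l x ≤ j := fun x hx =>
      (rank_le_rank_cons s K p l x).trans (hr x hx)
    by_cases hp : p.1 ∈ C ∧ p.2 ∈ K
    · have h1 := hr p.1 hp.1
      rw [rank, if_pos ⟨hCK hp.1, hp.2, self_mem_reachSet _ _ _⟩] at h1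
      have h2 : rank s K l p.1 + 1 ≤ j := (le_max_right _ _).trans h1
      -- The newest square had rank at most `j - 1` before its edge came, so this smaller set is
      -- nonempty. Monotonicity along edges puts every in-neighbour from `C` of a vertex of this set
      -- into the set too; hence no older edge is lost from the count, and the newest adds at most
      -- one.
      obtain ⟨x, hx, hxj⟩ := ih (j := j - 1) (C := C.filter fun x => rank s K l x ≤ j - 1)
        ((Finset.filter_subset _ _).trans hCK)
        ⟨p.1, Finset.mem_filter.2 ⟨hp.1, by lia⟩⟩ fun x hx => (Finset.mem_filter.1 hx).2
      obtain ⟨hxC, hxr⟩ := Finset.mem_filter.1 hx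
      refine ⟨x, hxC, ?_⟩
      have h3 : degreeIn l K C x ≤ degreeIn l K (C.filter fun x => rank s K l x ≤ j - 1) x := by
        refine List.countP_mono_left fun q hq hqx => ?_
        simp only [decide_eq_true_eq] at hqx ⊢
        refine hqx.imp_right fun ⟨h4, h5⟩ => ⟨h4, Finset.mem_filter.2 ⟨h5, ?_⟩⟩
        refine le_trans ?_ hxr
        exact rank_le_rank_of_edge hK (mem_restrict.2 ⟨h4 ▸ hq, hCK h5, hCK hxC⟩)
      rw [degreeIn, List.countP_cons]
      split_ifs <;> lia
    · obtain ⟨x, hx, hxj⟩ := ih hCK hC hr'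
      refine ⟨x, hx, ?_⟩
      rw [degreeIn, List.countP_cons_of_neg]
      · exact hxj
      · simp only [decide_eq_true_eq]
        rintro (⟨rfl, h⟩ | ⟨rfl, h⟩)
        · exact hp ⟨hx, h⟩
        · exact hp ⟨h, hCK hx⟩

end Rank

/-! ### Few vertices have a large rank -/

section Rare

variable {n : ℕ}

/-- The vertices that have rank at least `j` with respect to some set of at most `s` vertices. -/
noncomputable def rankSet (s j : ℕ) (l : List (Fin n × Fin n)) : Finset (Fin n) := by
  classical exact {x | ∃ K : Finset (Fin n), K.card ≤ s ∧ j ≤ rank s K l x}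

theorem mem_rankSet {s j : ℕ} {l : List (Fin n × Fin n)} {x : Fin n} :
    x ∈ rankSet s j l ↔ ∃ K : Finset (Fin n), K.card ≤ s ∧ j ≤ rank s K l x := by
  simp [rankSet]

theorem rankSet_nil (s j : ℕ) : rankSet s (j + 1) ([] : List (Fin n × Fin n)) = ∅ := by
  ext x
  simp [mem_rankSet, rank]

/-- A vertex newly reaching rank `j + 1` for some `K` inherits it from the square, which had rank at
least `j` for the same `K`. -/
theorem rankSet_cons_subset (s j : ℕ) (p : Fin n × Fin n) (l : List (Fin n × Fin n)) :
    rankSet s (j + 1) (p :: l) ⊆ rankSet s (j + 1) l ∪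
      if p.1 ∈ rankSet s j l then reachSet (p :: l) p.1 s else ∅ := by
  intro x hx
  obtain ⟨K, hK, hx⟩ := mem_rankSet.1 hx
  by_cases hxl : j + 1 ≤ rank s K l x
  · exact Finset.mem_union_left _ (mem_rankSet.2 ⟨K, hK, hxl⟩)
  refine Finset.mem_union_right _ ?_
  rw [rank] at hx
  split_ifs at hx with h1
  · have h2 : j ≤ rank s K l p.1 := by
      rcases le_max_iff.1 hx with h | h
      · exact absurd h hxl
      · lia
    rw [if_pos (mem_rankSet.2 ⟨K, hK, h2⟩)]
    exact reachSet_restrict_subset _ K _ _ h1.2.2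
  · exact absurd hx hxl

/-- The vertices that were the square in at least `j` steps. -/
noncomputable def outDegreeSet (j : ℕ) (l : List (Fin n × Fin n)) : Finset (Fin n) :=
  {x | j ≤ outDegree l x}

theorem mem_outDegreeSet {j : ℕ} {l : List (Fin n × Fin n)} {x : Fin n} :
    x ∈ outDegreeSet j l ↔ j ≤ outDegree l x := by
  simp [outDegreeSet]

theorem outDegreeSet_cons_subset (j : ℕ) (p : Fin n × Fin n) (l : List (Fin n × Fin n)) :
    outDegreeSet (j + 1) (p :: l) ⊆ outDegreeSet (j + 1) l ∪
      if p.1 ∈ outDegreeSet j l then {p.1} else ∅ := by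
  intro x hx
  rw [mem_outDegreeSet, outDegree, List.countP_cons] at hx
  by_cases hxl : j + 1 ≤ outDegree l x
  · exact Finset.mem_union_left _ (mem_outDegreeSet.2 hxl)
  refine Finset.mem_union_right _ ?_
  split_ifs at hx with h1
  · have h1 : p.1 = x := by simpa using h1
    subst h1
    rw [if_pos (mem_outDegreeSet.2 (by lia))]
    exact Finset.mem_singleton_self _
  · lia

/-- If membership in the `(j + 1)`-st set is only gained when a member of the `j`-th set is the
square, by at most `B` vertices at a time, then the `j`-th set is small on average. -/
theorem expect_card_le [NeZero n] (S : Strategy n) {Q : ℕ → List (Fin n × Fin n) → Finset (Fin n)}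
    {B : ℕ} (h0 : ∀ j, Q (j + 1) [] = ∅)
    (hQ : ∀ j p l, (Q (j + 1) (p :: l)).card ≤
      (Q (j + 1) l).card + if p.1 ∈ Q j l then B else 0) (t j : ℕ) :
    expect (pairLaw S t) (fun l => ((Q j l).card : ℝ≥0∞)) ≤ n * (B * t / n) ^ j := by
  have hn0 : (n : ℝ≥0∞) ≠ 0 := by exact_mod_cast NeZero.ne n
  induction t generalizing j with
  | zero =>
    cases j with
    | zero =>
      refine (expect_mono _ fun l => ?_).trans_eq (expect_const _ _)
      rw [pow_zero, mul_one]
      exact_mod_cast card_finset_fin_le _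
    | succ j => simp [pairLaw, expect_pure, h0]
  | succ t ih =>
    cases j with
    | zero =>
      refine (expect_mono _ fun l => ?_).trans_eq (expect_const _ _)
      rw [pow_zero, mul_one]
      exact_mod_cast card_finset_fin_le _
    | succ j =>
      -- The bound `hQ` holds for every circle, so the strategy drops out; averaging over the square
      -- then contributes `B |Q j l| / n`.
      have h1 : ∀ l u, expect (S t (edges l : Multigraph n) u)
          (fun v => ((Q (j + 1) ((u, v.1) :: l)).card : ℝ≥0∞)) ≤
          (Q (j + 1) l).card + if u ∈ Q j l then (B : ℝ≥0∞) else 0 := fun l u => by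
        refine (expect_mono _ fun v => ?_).trans_eq (expect_const _ _)
        have := hQ j (u, v.1) l
        split_ifs at this ⊢ <;> exact_mod_cast this
      have h2 : ∀ l, (n : ℝ≥0∞)⁻¹ * ∑ u, expect (S t (edges l : Multigraph n) u)
          (fun v => ((Q (j + 1) ((u, v.1) :: l)).card : ℝ≥0∞)) ≤
          (Q (j + 1) l).card + (n : ℝ≥0∞)⁻¹ * B * (Q j l).card := fun l => by
        refine (mul_le_mul_right (Finset.sum_le_sum fun u _ => h1 l u) _).trans_eq ?_
        rw [Finset.sum_add_distrib, mul_add, average_const]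
        congr 1
        rw [← Finset.sum_filter, Finset.sum_const, Finset.filter_mem_eq_inter, Finset.univ_inter,
          nsmul_eq_mul]
        ring
      rw [expect_pairLaw_succ]
      calc _ ≤ (n : ℝ≥0∞) * (B * t / n) ^ (j + 1) + (n : ℝ≥0∞)⁻¹ * B * (n * (B * t / n) ^ j) := by
            refine (expect_mono _ h2).trans ?_
            rw [expect_add, expect_const_mul]
            gcongr
            · exact ih _
            · exact ih _
        _ = (n : ℝ≥0∞) * (B / n) ^ (j + 1) * (t ^ (j + 1) + t ^ j) := by
            simp only [div_eq_mul_inv, mul_pow]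
            ring
        _ ≤ (n : ℝ≥0∞) * (B / n) ^ (j + 1) * (t + 1) ^ (j + 1) := by
            gcongr
            calc (t : ℝ≥0∞) ^ (j + 1) + t ^ j = t ^ j * (t + 1) := by ring
              _ ≤ (t + 1) ^ j * (t + 1) := by gcongr; exact le_self_add
              _ = _ := (pow_succ _ _).symm
        _ = _ := by
            push_cast
            simp only [div_eq_mul_inv, mul_pow]
            ring

open Classical in
/-- The sets of vertices of large rank, as long as no vertex was the square too often. -/
noncomputable def cappedRankSet (s d j : ℕ) (l : List (Fin n × Fin n)) : Finset (Fin n) :=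
  if ∀ x, outDegree l x ≤ d then rankSet s j l else ∅

/-- Out-degrees only grow, so once the cap is broken the set stays empty; until then it bounds the
size of the reachable set. -/
theorem card_cappedRankSet_cons_le (s d j : ℕ) (p : Fin n × Fin n) (l : List (Fin n × Fin n)) :
    (cappedRankSet s d (j + 1) (p :: l)).card ≤ (cappedRankSet s d (j + 1) l).card +
      if p.1 ∈ cappedRankSet s d j l then (d + 1) ^ s else 0 := by
  unfold cappedRankSet
  by_cases h : ∀ x, outDegree (p :: l) x ≤ d
  · have h' : ∀ x, outDegree l x ≤ d := fun x =>
      ((List.sublist_cons_self p l).countP_le).trans (h x)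
    rw [if_pos h, if_pos h', if_pos h']
    refine (Finset.card_le_card (rankSet_cons_subset s j p l)).trans ?_
    refine (Finset.card_union_le _ _).trans (Nat.add_le_add_left ?_ _)
    split_ifs
    · exact card_reachSet_le h _ _
    · simp
  · rw [if_neg h]
    simp

/-- Subgraphs on at most `s` vertices of minimum degree above `d` are unlikely to appear early. -/
theorem edgeLaw_dense_le [NeZero n] (S : Strategy n) (s d t : ℕ) :
    (edgeLaw S t).toOuterMeasure {l | ∃ K : Finset (Fin n), K.Nonempty ∧ K.card ≤ s ∧
      ∀ x ∈ K, d + 1 ≤ ((Multigraph.toSimpleGraph (l : Multigraph n)).neighborSet x ∩ K).ncard} ≤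
    n * (t / n) ^ (d + 1) + n * (((d + 1) ^ s : ℕ) * t / n) ^ (d + 1) := by
  rw [edgeLaw_eq_map_pairLaw, PMF.toOuterMeasure_map_apply]
  have hW := expect_card_le S (Q := outDegreeSet) (B := 1)
    (fun j => by ext x; simp [mem_outDegreeSet])
    (fun j p l => (Finset.card_le_card (outDegreeSet_cons_subset j p l)).trans
      ((Finset.card_union_le _ _).trans (by split_ifs <;> simp))) t (d + 1)
  have hR := expect_card_le S (Q := cappedRankSet s d) (B := (d + 1) ^ s)
    (fun j => by simp [cappedRankSet, rankSet_nil]) (card_cappedRankSet_cons_le s d) t (d + 1)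
  rw [Nat.cast_one, one_mul] at hW
  refine le_trans ?_ (add_le_add hW hR)
  rw [← expect_add]
  refine toOuterMeasure_le_expect _ fun l hl => ?_
  obtain ⟨K, hne, hcard, hdeg⟩ := hl
  have key : 1 ≤ (outDegreeSet (d + 1) l).card + (cappedRankSet s d (d + 1) l).card := by
    by_cases hcap : ∀ x, outDegree l x ≤ d
    · refine le_add_left (Finset.card_pos.2 ?_)
      rw [cappedRankSet, if_pos hcap]
      by_contra hemp
      rw [Finset.not_nonempty_iff_eq_empty] at hemp
      obtain ⟨x, hx, hxd⟩ := exists_degreeIn_le hcard l subset_rfl hne (j := d) fun x _ => by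
        by_contra! hx
        have : x ∈ rankSet s (d + 1) l := mem_rankSet.2 ⟨K, hcard, hx⟩
        simp [hemp] at this
      refine absurd (hdeg x hx) (not_le.2 (Nat.lt_succ_of_le (le_trans ?_ hxd)))
      -- The other end of a pair at `x`; every neighbour of `x` in `K` arises from a pair counted by
      -- `degreeIn`.
      let f : Fin n × Fin n → Fin n := fun p => if p.1 = x then p.2 else p.1
      let L := (l.filter fun p => (p.1 = x ∧ p.2 ∈ K) ∨ (p.2 = x ∧ p.1 ∈ K)).map f
      have hsub : (Multigraph.toSimpleGraph ((edges l : List _) : Multigraph n)).neighborSet x ∩ K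
          ⊆ (L.toFinset : Set (Fin n)) := by
        rintro y ⟨hy, hyK⟩
        obtain ⟨hy, hxy⟩ : s(x, y) ∈ edges l ∧ x ≠ y := by
          simpa [Multigraph.toSimpleGraph] using hy
        obtain ⟨p, hp, hpe⟩ := List.mem_map.1 hy
        rw [Finset.mem_coe, List.mem_toFinset]
        refine List.mem_map.2 ⟨p, List.mem_filter.2 ⟨hp, ?_⟩, ?_⟩
        · rcases Sym2.eq_iff.1 hpe with ⟨h1, h2⟩ | ⟨h1, h2⟩
          · simpa [h1, h2] using Or.inl hyK
          · simpa [h1, h2] using Or.inr hyK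
        · rcases Sym2.eq_iff.1 hpe with ⟨h1, h2⟩ | ⟨h1, h2⟩
          · simp [f, h1, h2]
          · simp [f, h1, hxy.symm]
      calc _ ≤ (L.toFinset : Set (Fin n)).ncard := Set.ncard_le_ncard hsub
        _ ≤ L.length := by rw [Set.ncard_coe_finset]; exact List.toFinset_card_le _
        _ = _ := by rw [List.length_map, ← List.countP_eq_length_filter]
    · push Not at hcap
      obtain ⟨x, hx⟩ := hcap
      exact le_add_right (Finset.card_pos.2 ⟨x, mem_outDegreeSet.2 hx⟩)
  exact_mod_cast key

end Rare

/-! ### Degeneracy -/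

section Degeneracy

variable {V : Type*}

theorem isDegenerate_degeneracy [Finite V] (G : SimpleGraph V) : IsDegenerate G (degeneracy G) := by
  refine Nat.sInf_mem (s := {k | IsDegenerate G k}) ⟨Nat.card V, fun s ⟨v, hv⟩ => ⟨v, hv, ?_⟩⟩
  exact Set.ncard_le_card _

theorem exists_dense_of_lt_degeneracy {G : SimpleGraph V} {k : ℕ} (h : k < degeneracy G) :
    ∃ s : Set V, s.Nonempty ∧ ∀ v ∈ s, k + 1 ≤ (G.neighborSet v ∩ s).ncard := by
  have h1 : ¬ IsDegenerate G k := fun hk => Nat.notMem_of_lt_sInf h hk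
  simpa [IsDegenerate, Nat.succ_le_iff] using h1

theorem two_le_degeneracy [Finite V] {G : SimpleGraph V} (h : ¬ G.IsAcyclic) :
    2 ≤ degeneracy G := by
  simp only [SimpleGraph.IsAcyclic, not_forall, not_not] at h
  obtain ⟨v, c, hc⟩ := h
  -- Each vertex of a cycle already has two neighbours on it.
  obtain ⟨x, hx, hxd⟩ := isDegenerate_degeneracy G {x | x ∈ c.support} ⟨v, c.start_mem_support⟩
  refine le_trans ?_ hxd
  rw [← hc.ncard_neighborSet_toSubgraph_eq_two hx]
  refine Set.ncard_le_ncard (fun y hy => ⟨hy.adj_sub, ?_⟩)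
  exact (SimpleGraph.Walk.mem_verts_toSubgraph _).1 (SimpleGraph.Subgraph.edge_vert _ hy.symm)

end Degeneracy

/-! ### Containment of graphs from the family -/

section Containment

theorem toSimpleGraph_mono {n : ℕ} {G G' : Multigraph n} (h : G ≤ G') :
    Multigraph.toSimpleGraph G ≤ Multigraph.toSimpleGraph G' :=
  SimpleGraph.fromEdgeSet_mono fun _ he => Multiset.mem_of_le h he

variable {ι : Type*} {V : ι → Type*} {H : ∀ i, SimpleGraph (V i)}

theorem containsSome_mono {n : ℕ} (G G' : Multigraph n) (h : G ≤ G') :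
    ContainsSome H n G → ContainsSome H n G' :=
  fun ⟨i, hi⟩ => ⟨i, hi.mono_right (toSimpleGraph_mono h)⟩

theorem not_containsSome_zero (hH : ∀ i, ¬ (H i).IsAcyclic) (n : ℕ) :
    ¬ ContainsSome H n (0 : Multigraph n) := by
  rintro ⟨i, ⟨f⟩⟩
  refine hH i ?_
  have : H i = ⊥ := by
    ext x y
    simp only [SimpleGraph.bot_adj, iff_false]
    intro h
    simpa [Multigraph.toSimpleGraph] using f.toHom.map_adj h
  rw [this]
  exact SimpleGraph.isAcyclic_bot

theorem exists_dense_of_isContained {W : Type*} [Finite W] {F : SimpleGraph W} {n k s : ℕ}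
    {G : SimpleGraph (Fin n)} (h : F.IsContained G) (hk : k < degeneracy F) (hs : Nat.card W ≤ s) :
    ∃ K : Finset (Fin n), K.Nonempty ∧ K.card ≤ s ∧
      ∀ x ∈ K, k + 1 ≤ (G.neighborSet x ∩ K).ncard := by
  classical
  have := Fintype.ofFinite W
  obtain ⟨f⟩ := h
  obtain ⟨A, hA, hdeg⟩ := exists_dense_of_lt_degeneracy hk
  refine ⟨A.toFinset.image f, by simpa using hA, ?_, ?_⟩
  · refine Finset.card_image_le.trans ((Finset.card_le_univ _).trans ?_)
    rwa [← Nat.card_eq_fintype_card]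
  · intro x hx
    obtain ⟨v, hv, rfl⟩ := Finset.mem_image.1 hx
    refine (hdeg v (by simpa using hv)).trans ?_
    rw [← Set.ncard_image_of_injective _ f.injective]
    refine Set.ncard_le_ncard ?_
    rintro _ ⟨y, ⟨hy, hyA⟩, rfl⟩
    exact ⟨f.toHom.map_adj hy, by simpa using ⟨y, hyA, rfl⟩⟩

end Containment

/-! ### No strategy is fast: the first claim -/

section LowerBound

/-- `⌊α n ^ ((d - 1) / d)⌋ ^ d ≤ α ^ d n ^ (d - 1)`. -/
theorem floor_rpow_pow_le {α : ℝ} (hα : 0 ≤ α) (n e : ℕ) :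
    (⌊α * (n : ℝ) ^ (((e + 1 : ℕ) - 1 : ℝ) / (e + 1 : ℕ))⌋₊ : ℝ) ^ (e + 1) ≤
      α ^ (e + 1) * n ^ e := by
  have h1 : (⌊α * (n : ℝ) ^ (((e + 1 : ℕ) - 1 : ℝ) / (e + 1 : ℕ))⌋₊ : ℝ) ≤ _ :=
    Nat.floor_le (by positivity)
  refine (pow_le_pow_left₀ (by positivity) h1 _).trans_eq ?_
  rw [mul_pow, ← Real.rpow_mul_natCast (by positivity), div_mul_cancel₀ _ (by positivity)]
  push_cast
  rw [add_sub_cancel_right, Real.rpow_natCast]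

theorem probAt_containsSome_le_half {ι : Type*} {V : ι → Type*} [∀ i, Finite (V i)]
    {H : ∀ i, SimpleGraph (V i)} {e s : ℕ} (he : 1 ≤ e) (hd : ∀ i, e < degeneracy (H i))
    (hs : ∀ i, Nat.card (V i) ≤ s) {n : ℕ} [NeZero n] (S : Strategy n) :
    probAt S (ContainsSome H n) ⌊(1 / (2 * (e + 1) ^ s) : ℝ) *
      (n : ℝ) ^ (((e + 1 : ℕ) - 1 : ℝ) / (e + 1 : ℕ))⌋₊ ≤ 1 / 2 := by
  -- Chosen so that `(e + 1) ^ s * α = 1 / 2`; each of the two error terms is then at most `(1 / 2)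
  -- ^ (e + 1) ≤ 1 / 4`.
  set α : ℝ := 1 / (2 * (e + 1) ^ s) with hα
  have hα0 : 0 ≤ α := by positivity
  have hm := floor_rpow_pow_le hα0 n e
  set m := ⌊α * (n : ℝ) ^ (((e + 1 : ℕ) - 1 : ℝ) / (e + 1 : ℕ))⌋₊
  have hn : (0 : ℝ) < n := by exact_mod_cast NeZero.pos n
  have hreal : (n : ℝ) * (((e + 1) ^ s : ℕ) * m / n) ^ (e + 1) ≤ 1 / 4 := by
    calc (n : ℝ) * (((e + 1) ^ s : ℕ) * m / n) ^ (e + 1)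
        = ((e + 1) ^ s : ℝ) ^ (e + 1) * (m : ℝ) ^ (e + 1) / n ^ e := by
          push_cast
          rw [div_pow, mul_pow, pow_succ (n : ℝ) e]
          field_simp
      _ ≤ ((e + 1) ^ s : ℝ) ^ (e + 1) * (α ^ (e + 1) * n ^ e) / n ^ e := by gcongr
      _ = ((e + 1) ^ s * α) ^ (e + 1) := by
          rw [mul_pow]
          field_simp
      _ = (1 / 2) ^ (e + 1) := by
          congr 1
          rw [hα]
          field_simp
      _ ≤ (1 / 2) ^ 2 := pow_le_pow_of_le_one (by norm_num) (by norm_num) (by lia)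
      _ = 1 / 4 := by norm_num
  have h4 : (n : ℝ≥0∞) * (((e + 1) ^ s : ℕ) * m / n) ^ (e + 1) ≤ ENNReal.ofReal (1 / 4) := by
    refine le_trans (le_of_eq ?_) (ENNReal.ofReal_le_ofReal hreal)
    rw [ENNReal.ofReal_mul hn.le, ENNReal.ofReal_pow (by positivity), ENNReal.ofReal_div_of_pos hn,
      ENNReal.ofReal_mul (by positivity)]
    simp only [ENNReal.ofReal_natCast]
  refine ENNReal.toReal_le_of_le_ofReal (by norm_num) ?_
  calc (edgeLaw S m).toOuterMeasure {l | ContainsSome H n (l : Multigraph n)}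
      ≤ _ := MeasureTheory.measure_mono fun l ⟨i, hi⟩ =>
        exists_dense_of_isContained hi (hd i) (hs i)
    _ ≤ _ := edgeLaw_dense_le S s e m
    _ ≤ (n : ℝ≥0∞) * (((e + 1) ^ s : ℕ) * m / n) ^ (e + 1) +
        (n : ℝ≥0∞) * (((e + 1) ^ s : ℕ) * m / n) ^ (e + 1) := by
      gcongr
      refine le_mul_of_one_le_left zero_le ?_
      exact_mod_cast Nat.one_le_pow _ _ (by lia)
    _ ≤ ENNReal.ofReal (1 / 4) + ENNReal.ofReal (1 / 4) := add_le_add h4 h4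
    _ = ENNReal.ofReal (1 / 2) := by
      rw [← ENNReal.ofReal_add (by norm_num) (by norm_num)]
      norm_num

end LowerBound

/-! ### Absence of a sharp threshold -/

section Sharp

theorem not_isSharpThreshold {P : ∀ n : ℕ, Multigraph n → Prop}
    (hP : ∀ n (G G' : Multigraph n), G ≤ G' → P n G → P n G') (h0 : ∀ n, ¬ P n 0) {f : ℕ → ℝ}
    (hlow : ∃ α : ℝ, 0 < α ∧ ∀ (n : ℕ) [NeZero n] (S : Strategy n),
      probAt S (P n) ⌊α * f n⌋₊ ≤ 1 / 2)
    (hupp : ∀ β : ℝ, 0 < β → ∃ δ : ℝ, 0 < δ ∧ ∃ N : ℕ, ∀ (n : ℕ) [NeZero n], N ≤ n →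
      ∃ S : Strategy n, δ ≤ probAt S (P n) ⌊β * f n⌋₊) (st : ℕ → ℝ) :
    ¬ IsSharpThreshold P st := by
  intro hst
  obtain ⟨α, hα, hlow⟩ := hlow
  -- With `ε = 1 / 2` the two time bounds have ratio `(1 - ε) / (1 + ε) = 1 / 3`. Success by the
  -- later one forces it beyond `α f`, so the earlier one is beyond `(α / 3) f`, where probability
  -- `δ` is available.
  obtain ⟨δ, hδ, N, hupp⟩ := hupp (α / 3) (by positivity)
  obtain ⟨⟨S, hS⟩, hall⟩ := hst (1 / 2) (by norm_num)
  simp only [probHit_eq_probAt _ (hP _) (h0 _)] at hS hall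
  have hex : ∀ n : ℕ, ∃ S : Strategy (n + 2), N ≤ n + 2 →
      δ ≤ probAt S (P (n + 2)) ⌊α / 3 * f (n + 2)⌋₊ := fun n => by
    by_cases hn : N ≤ n + 2
    · obtain ⟨S, hS⟩ := hupp (n + 2) hn
      exact ⟨S, fun _ => hS⟩
    · exact ⟨S n, fun h => absurd h hn⟩
  choose S' hS' using hex
  obtain ⟨n, hn1, hn2, hn3⟩ := ((hS.eventually (lt_mem_nhds (by norm_num : (1 / 2 : ℝ) < 1))).and
    (((hall S').eventually (gt_mem_nhds hδ)).and (Filter.eventually_ge_atTop N))).exists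
  have h1 : α * f (n + 2) < (1 + 1 / 2) * st (n + 2) := by
    by_contra! hcon
    have := probAt_mono (S n) (hP _) (Nat.floor_mono hcon)
    have := hlow (n + 2) (S n)
    linarith
  have h2 : α / 3 * f (n + 2) ≤ (1 - 1 / 2) * st (n + 2) := by linarith
  have := probAt_mono (S' n) (hP _) (Nat.floor_mono h2)
  have := hS' n (by lia)
  linarith

end Sharp

/-! ### Building a copy vertex by vertex -/

section Build

variable {n : ℕ}

open Classical in
/-- The vertices of `A` that are joined to `w`. -/
noncomputable def joinedTo (A : Finset (Fin n)) (w : Fin n) (G : Multigraph n) : Finset (Fin n) :=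
  A.filter fun x => (Multigraph.toSimpleGraph G).Adj w x

theorem mem_joinedTo {A : Finset (Fin n)} {w x : Fin n} {G : Multigraph n} :
    x ∈ joinedTo A w G ↔ x ∈ A ∧ (Multigraph.toSimpleGraph G).Adj w x := by
  simp [joinedTo]

theorem joinedTo_subset (A : Finset (Fin n)) (w : Fin n) (G : Multigraph n) :
    joinedTo A w G ⊆ A :=
  fun _ hx => (mem_joinedTo.1 hx).1

theorem joinedTo_mono (A : Finset (Fin n)) (w : Fin n) : Monotone (joinedTo A w) :=
  fun _ _ h _ hx => mem_joinedTo.2 ((mem_joinedTo.1 hx).imp_right fun h' => toSimpleGraph_mono h h')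

/-- A potential that is halved whenever `b` grows and vanishes when `b` reaches `k`. -/
noncomputable def halving (k b : ℕ) : ℝ := if k ≤ b then 0 else 2 ^ (k - 1 - b)

theorem halving_nonneg (k b : ℕ) : 0 ≤ halving k b := by
  unfold halving
  split_ifs <;> positivity

theorem halving_antitone (k : ℕ) : Antitone (halving k) := by
  intro b b' h
  unfold halving
  split_ifs
  · exact le_rfl
  · positivity
  · lia
  · exact pow_le_pow_right₀ (by norm_num) (by lia)

theorem halving_succ_le {k b : ℕ} (h : b < k) : halving k (b + 1) ≤ halving k b / 2 := by
  unfold halving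
  split_ifs with h1 h2 h2
  · lia
  · positivity
  · lia
  · have : k - 1 - b = k - 1 - (b + 1) + 1 := by lia
    rw [this, pow_succ]
    simp

theorem halving_le (k b : ℕ) : halving k b ≤ 2 ^ (k - 1) := by
  unfold halving
  split_ifs
  · positivity
  · exact pow_le_pow_right₀ (by norm_num) (by lia)

theorem one_le_halving {k b : ℕ} (h : b < k) : 1 ≤ halving k b := by
  rw [halving, if_neg (by lia)]
  exact one_le_pow₀ (by norm_num)

variable [NeZero n]

/-- In `r` steps the player can join `k` vertices of a large set `A` to a vertex `w`. -/
theorem le_valueSet_joinedTo (hn : 2 ≤ n) {A : Finset (Fin n)} {w : Fin n} (hw : w ∉ A) {k : ℕ}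
    (hA : 2 * (k - 1) ≤ A.card) (r : ℕ) (G : Multigraph n) :
    ENNReal.ofReal (1 - 2 ^ (k - 1) * Real.exp (-(r * A.card / (4 * n)))) ≤
      valueSet {G | k ≤ (joinedTo A w G).card} r G := by
  classical
  have hn0 : (0 : ℝ) < n := by exact_mod_cast NeZero.pos n
  have hAn : (A.card : ℝ) ≤ n := by exact_mod_cast card_finset_fin_le A
  have hx0 : (0 : ℝ) ≤ 1 - A.card / (4 * n) := by
    rw [sub_nonneg, div_le_one (by positivity)]
    linarith
  -- Every square in `A` is joined to `w`; the other squares are wasted.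
  let c : ∀ u : Fin n, {v // v ≠ u} := fun u =>
    if h : u ∈ A then ⟨w, fun h' => hw (h' ▸ h)⟩ else (nonempty_circle hn u).some
  let b : Multigraph n → ℕ := fun G => (joinedTo A w G).card
  have hup : IsUpperSet {G : Multigraph n | k ≤ b G} := fun G G' h hG =>
    le_trans hG (Finset.card_le_card (joinedTo_mono A w h))
  have hstep : ∀ G, b G < k → ∀ u, halving k (b (s(u, (c u).1) ::ₘ G)) ≤
      halving k (b G) - if u ∈ A \ joinedTo A w G then halving k (b G) / 2 else 0 := by
    intro G hG u
    have hsub := joinedTo_mono A w (Multiset.le_cons_self G s(u, (c u).1))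
    split_ifs with hu
    · obtain ⟨huA, hu⟩ := Finset.mem_sdiff.1 hu
      have hcu : (c u).1 = w := by simp [c, huA]
      have hmem : u ∈ joinedTo A w (s(u, (c u).1) ::ₘ G) := by
        refine mem_joinedTo.2 ⟨huA, ?_⟩
        have : w ≠ u := fun h => hw (h ▸ huA)
        simp [Multigraph.toSimpleGraph, hcu, this, Sym2.eq_swap]
      have hlt : b G + 1 ≤ b (s(u, (c u).1) ::ₘ G) :=
        Finset.card_lt_card ((Finset.ssubset_iff_of_subset hsub).2 ⟨u, hmem, hu⟩)
      have := halving_antitone k hlt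
      have := halving_succ_le hG
      linarith
    · rw [sub_zero]
      exact halving_antitone k (Finset.card_le_card hsub)
  have hdrift : ∀ G ∉ {G : Multigraph n | k ≤ b G},
      (n : ℝ≥0∞)⁻¹ * ∑ u, ENNReal.ofReal (halving k (b (s(u, (c u).1) ::ₘ G))) ≤
        ENNReal.ofReal (1 - A.card / (4 * n)) * ENNReal.ofReal (halving k (b G)) := by
    intro G hG
    have hG : b G < k := by simpa using hG
    -- At most `k - 1` vertices are joined so far, so half of `A` is still useful: with probability
    -- at least `|A| / (2n)` the potential halves, whence the factor `1 - |A| / (4n)`.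
    have hcard : (A.card : ℝ) / 2 ≤ (A \ joinedTo A w G).card := by
      have h1 := Finset.card_sdiff_add_card_eq_card
        (joinedTo_subset A w G)
      have h2 : A.card ≤ 2 * (A \ joinedTo A w G).card := by
        simp only [b] at hG
        lia
      rw [div_le_iff₀ (by norm_num), mul_comm]
      exact_mod_cast h2
    have hsum : ∑ u, halving k (b (s(u, (c u).1) ::ₘ G)) ≤
        n * ((1 - A.card / (4 * n)) * halving k (b G)) := by
      refine (Finset.sum_le_sum fun u _ => hstep G hG u).trans ?_
      rw [Finset.sum_sub_distrib, Finset.sum_const, ← Finset.sum_filter, Finset.sum_const,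
        Finset.filter_mem_eq_inter, Finset.univ_inter, Finset.card_univ, Fintype.card_fin,
        nsmul_eq_mul, nsmul_eq_mul]
      have h1 := mul_le_mul_of_nonneg_right hcard (halving_nonneg k (b G))
      have h2 : (n : ℝ) * ((1 - A.card / (4 * n)) * halving k (b G)) =
          n * halving k (b G) - A.card / 2 * halving k (b G) / 2 := by
        field_simp
        ring
      rw [h2]
      linarith
    rw [← ENNReal.ofReal_sum_of_nonneg fun u _ => halving_nonneg _ _, ← ENNReal.ofReal_mul hx0,
      ← ENNReal.ofReal_natCast n, ← ENNReal.ofReal_inv_of_pos hn0,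
      ← ENNReal.ofReal_mul (by positivity)]
    refine ENNReal.ofReal_le_ofReal ?_
    rwa [inv_mul_le_iff₀ hn0]
  have hmain := one_le_valueSet_add hn hup (fun G => ENNReal.ofReal (halving k (b G)))
    (ENNReal.ofReal (1 - A.card / (4 * n))) c
    (fun G hG => by
      rw [ENNReal.one_le_ofReal]
      exact one_le_halving (by simpa using hG)) hdrift r G
  rw [ENNReal.ofReal_sub _ (by positivity), ENNReal.ofReal_one, tsub_le_iff_right]
  refine hmain.trans (add_le_add_right ?_ _)
  rw [← ENNReal.ofReal_pow hx0, ← ENNReal.ofReal_mul (by positivity)]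
  refine ENNReal.ofReal_le_ofReal ?_
  rw [mul_comm]
  refine mul_le_mul (halving_le _ _) ?_ (by positivity) (by positivity)
  calc (1 - A.card / (4 * n) : ℝ) ^ r ≤ Real.exp (-(A.card / (4 * n))) ^ r := by
        gcongr
        have := Real.add_one_le_exp (-(A.card / (4 * n) : ℝ))
        linarith
    _ = _ := by
        rw [← Real.exp_nat_mul]
        congr 1
        ring

theorem half_le_valueSet_joinedTo (hn : 2 ≤ n) {A : Finset (Fin n)} {w : Fin n} (hw : w ∉ A)
    {k q : ℕ} (hk : 1 ≤ k) (hA : 2 * k ≤ A.card) (hq : 8 * n * k ≤ q * A.card) (G : Multigraph n) :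
    ENNReal.ofReal (1 / 2) ≤ valueSet {G | k ≤ (joinedTo A w G).card} q G := by
  have hn0 : (0 : ℝ) < n := by exact_mod_cast NeZero.pos n
  refine le_trans (ENNReal.ofReal_le_ofReal ?_) (le_valueSet_joinedTo hn hw (by lia) q G)
  have h1 : (2 * k : ℝ) ≤ q * A.card / (4 * n) := by
    rw [le_div_iff₀ (by positivity)]
    have : (8 * n * k : ℝ) ≤ q * A.card := by exact_mod_cast hq
    linarith
  have h2 : (2 : ℝ) ^ k ≤ Real.exp (q * A.card / (4 * n)) := by
    calc (2 : ℝ) ^ k ≤ Real.exp 1 ^ k := by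
          gcongr
          linarith [Real.add_one_le_exp (1 : ℝ)]
      _ = Real.exp k := by rw [← Real.exp_nat_mul, mul_one]
      _ ≤ _ := Real.exp_le_exp.2 (by linarith [Nat.cast_nonneg (α := ℝ) k])
  have h3 : (2 : ℝ) ^ (k - 1) * 2 = 2 ^ k := by
    rw [← pow_succ, Nat.sub_add_cancel hk]
  have h4 : (2 : ℝ) ^ (k - 1) * Real.exp (-(q * A.card / (4 * n))) ≤ 1 / 2 := by
    rw [Real.exp_neg, ← div_eq_mul_inv, div_le_iff₀ (Real.exp_pos _)]
    linarith
  linarith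

/-- The set of multigraphs in which at least `y` vertices outside `Z` are joined to all of `T`. -/
def ManyJoined (Z T : Finset (Fin n)) (y : ℝ) : Set (Multigraph n) :=
  {G | ∃ A : Finset (Fin n), Disjoint A Z ∧ y ≤ A.card ∧
    ∀ x ∈ A, ∀ w ∈ T, (Multigraph.toSimpleGraph G).Adj w x}

/-- The numerical relations between the number `n = x ^ (e + 1)` of vertices, the number `q` of
steps per round and the fraction `c` of vertices that survive a round. -/
structure RoundParams (n q e : ℕ) (x γ c : ℝ) : Prop where
  one_le : 1 ≤ x
  pow_eq : x ^ (e + 1) = n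
  le_q : γ * x ^ e ≤ q
  c_pos : 0 < c
  c_le : 4 * c ≤ 1
  c_le' : 16 * c ≤ γ
  two_le : 2 ≤ c ^ e * x

/-- One round of `q` steps is spent on each vertex of `T`. It meets about `q |A| / n` candidates, of
order `|A| / x`, and keeps at least `c |A| / x` of them with probability at least `1 / 2`. -/
theorem le_valueSet_manyJoined (hn : 2 ≤ n) {q e : ℕ} {x γ c : ℝ} (h : RoundParams n q e x γ c)
    {Z : Finset (Fin n)} (hZ : 2 * Z.card ≤ n) (T : Finset (Fin n)) (hTZ : T ⊆ Z)
    (hT : T.card ≤ e) (G : Multigraph n) :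
    ENNReal.ofReal ((1 / 2) ^ T.card) ≤
      valueSet (ManyJoined Z T (c ^ T.card / 2 * x ^ (e + 1 - T.card))) (T.card * q) G := by
  obtain ⟨hx1, hxn, hq, hc, hc1, hcγ, hcx⟩ := h
  have hx0 : 0 < x := by linarith
  induction T using Finset.induction_on generalizing G with
  | empty =>
    refine le_trans ?_ (one_le_valueSet hn ?_ _)
    · simp
    · refine fun G' _ => ⟨Zᶜ, disjoint_compl_left, ?_, by simp⟩
      have : n ≤ 2 * Zᶜ.card := by
        rw [Finset.card_compl, Fintype.card_fin]
        lia
      have : (n : ℝ) ≤ 2 * Zᶜ.card := by exact_mod_cast this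
      simp only [Finset.card_empty, pow_zero, Nat.sub_zero, hxn]
      linarith
  | insert w T hwT ih =>
    rw [Finset.card_insert_of_notMem hwT] at hT ⊢
    set a := T.card
    have hwZ : w ∈ Z := hTZ (Finset.mem_insert_self _ _)
    rw [pow_succ, ENNReal.ofReal_mul (by positivity), Nat.succ_mul]
    refine mul_le_valueSet_add (ih ((Finset.subset_insert _ _).trans hTZ) (by lia) G) ?_
    rintro G' ⟨A, hAZ, hA, hAT⟩ -
    have hwA : w ∉ A := fun hwA => Finset.disjoint_left.1 hAZ hwA hwZ
    set y := c ^ (a + 1) / 2 * x ^ (e + 1 - (a + 1)) with hy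
    have hye : e + 1 - a = e + 1 - (a + 1) + 1 := by lia
    -- This is the purpose of `two_le`: rounding `y` up at most doubles it. Then `c_le` ensures that
    -- `A` is large enough and `c_le'` that the round is long enough.
    have hy1 : 1 ≤ y := by
      have h1 : c ^ e ≤ c ^ (a + 1) := pow_le_pow_of_le_one hc.le (by linarith) hT
      have h2 : x ≤ x ^ (e + 1 - (a + 1)) := le_self_pow₀ hx1 (by lia)
      have h3 : c ^ e * x ≤ c ^ (a + 1) * x ^ (e + 1 - (a + 1)) := by gcongr
      rw [hy]
      linarith
    have hk : (⌈y⌉₊ : ℝ) ≤ 2 * y := by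
      have := (Nat.ceil_lt_add_one (by linarith : 0 ≤ y)).le
      linarith
    have hAy : y * x ≤ c * A.card := by
      calc y * x = c * (c ^ a / 2 * x ^ (e + 1 - a)) := by rw [hy, hye]; ring
        _ ≤ _ := by gcongr
    have h2k : 2 * ⌈y⌉₊ ≤ A.card := by
      have h1 : y ≤ y * x := le_mul_of_one_le_right (by linarith) hx1
      have h2 : 4 * c * A.card ≤ 1 * A.card := by gcongr
      have : (2 * ⌈y⌉₊ : ℝ) ≤ A.card := by linarith
      exact_mod_cast this
    have h8k : 8 * n * ⌈y⌉₊ ≤ q * A.card := by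
      have : (8 * n * ⌈y⌉₊ : ℝ) ≤ q * A.card := by
        calc (8 * n * ⌈y⌉₊ : ℝ) ≤ 8 * n * (2 * y) := by gcongr
          _ = 16 * x ^ e * (y * x) := by rw [← hxn]; ring
          _ ≤ 16 * x ^ e * (c * A.card) := by gcongr
          _ = 16 * c * x ^ e * A.card := by ring
          _ ≤ γ * x ^ e * A.card := by gcongr
          _ ≤ _ := by gcongr
      exact_mod_cast this
    refine (half_le_valueSet_joinedTo hn hwA (Nat.ceil_pos.2 (by linarith)) h2k h8k G').trans
      (valueSet_mono_left _ fun G'' hG'' hle => ⟨joinedTo A w G'', ?_, ?_, ?_⟩)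
    · exact hAZ.mono_left (joinedTo_subset A w G'')
    · exact (Nat.le_ceil y).trans (by exact_mod_cast hG'')
    · intro v hv u hu
      obtain ⟨hvA, hvw⟩ := mem_joinedTo.1 hv
      rcases Finset.mem_insert.1 hu with rfl | hu
      · exact hvw
      · exact toSimpleGraph_mono hle (hAT v hvA u hu)

/-- The probability with which one more vertex can be attached. -/
noncomputable def attachProb (e : ℕ) (γ c : ℝ) : ℝ :=
  (1 / 2) ^ e * (1 - Real.exp (-(γ * c ^ e / 8)))

theorem attachProb_pos {e : ℕ} {γ c : ℝ} (hγ : 0 < γ) (hc : 0 < c) : 0 < attachProb e γ c := by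
  have : Real.exp (-(γ * c ^ e / 8)) < 1 := Real.exp_lt_one_iff.2 (by simp; positivity)
  exact mul_pos (by positivity) (by linarith)

theorem attachProb_le_one (e : ℕ) (γ c : ℝ) : attachProb e γ c ≤ 1 := by
  have h1 : 1 - Real.exp (-(γ * c ^ e / 8)) ≤ 1 := by linarith [Real.exp_pos (-(γ * c ^ e / 8))]
  have h2 : ((1 : ℝ) / 2) ^ e ≤ 1 := pow_le_one₀ (by norm_num) (by norm_num)
  have h3 : (0 : ℝ) < (1 / 2) ^ e := by positivity
  calc attachProb e γ c ≤ (1 / 2) ^ e * 1 := mul_le_mul_of_nonneg_left h1 h3.le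
    _ ≤ 1 := by linarith

/-- One vertex `w` of `T` is kept for last. The at least `c ^ e x / 2` candidates for the others
make `q |A| / n` bounded below, and a single hit suffices. -/
theorem le_valueSet_attach (hn : 2 ≤ n) {q e : ℕ} {x γ c : ℝ} (h : RoundParams n q e x γ c)
    {Z : Finset (Fin n)} (hZ : 2 * Z.card ≤ n) {T : Finset (Fin n)} (hTZ : T ⊆ Z)
    (hT : T.card ≤ e + 1) (G : Multigraph n) :
    ENNReal.ofReal (attachProb e γ c) ≤ valueSet {G | ∃ v ∉ Z, ∀ w ∈ T,
      (Multigraph.toSimpleGraph G).Adj w v} ((e + 1) * q) G := by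
  have hup : IsUpperSet {G | ∃ v ∉ Z, ∀ w ∈ T, (Multigraph.toSimpleGraph G).Adj w v} :=
    fun G G' h ⟨v, hv, hvT⟩ => ⟨v, hv, fun w hw => toSimpleGraph_mono h (hvT w hw)⟩
  have hx1 := h.one_le
  have hc := h.c_pos
  have hx0 : 0 < x := by linarith
  have hγ : 0 < γ := by linarith [h.c_le']
  rcases T.eq_empty_or_nonempty with rfl | ⟨w, hw⟩
  · have hex : ∃ v, v ∉ Z := by
      by_contra! hcon
      have := Finset.card_eq_of_equiv_fin (Equiv.subtypeUnivEquiv hcon)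
      lia
    obtain ⟨v, hv⟩ := hex
    refine le_trans ?_ (one_le_valueSet hn (fun G' _ => Set.mem_ofPred.2 ⟨v, hv, by simp⟩) _)
    rw [ENNReal.ofReal_le_one]
    exact attachProb_le_one e γ c
  · set a := (T.erase w).card
    have ha : a + 1 = T.card := Finset.card_erase_add_one hw
    have hae : a ≤ e := by lia
    refine le_trans ?_ (valueSet_mono_right hn hup
      (Nat.mul_le_mul_right q (by lia : a + 1 ≤ e + 1)) G)
    have hle : attachProb e γ c ≤ (1 / 2) ^ a * (1 - Real.exp (-(γ * c ^ e / 8))) := by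
      refine mul_le_mul_of_nonneg_right
        (pow_le_pow_of_le_one (by norm_num) (by norm_num) hae) ?_
      have : Real.exp (-(γ * c ^ e / 8)) ≤ 1 := Real.exp_le_one_iff.2 (by simp; positivity)
      linarith
    refine (ENNReal.ofReal_le_ofReal hle).trans ?_
    rw [ENNReal.ofReal_mul (by positivity), Nat.succ_mul]
    refine mul_le_valueSet_add (le_valueSet_manyJoined hn h hZ (T.erase w)
      ((Finset.erase_subset _ _).trans hTZ) hae G) ?_
    rintro G' ⟨A, hAZ, hA, hAT⟩ -
    have hwA : w ∉ A := fun hwA => Finset.disjoint_left.1 hAZ hwA (hTZ hw)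
    refine le_trans (ENNReal.ofReal_le_ofReal ?_) ((le_valueSet_joinedTo hn hwA (k := 1) (by simp)
      q G').trans (valueSet_mono_left _ fun G'' hG'' hle => ?_))
    · have hn0 : (0 : ℝ) < n := by exact_mod_cast NeZero.pos n
      have key : γ * c ^ e / 8 ≤ q * A.card / (4 * n) := by
        rw [le_div_iff₀ (by positivity)]
        have hA' : c ^ e / 2 * x ≤ A.card := by
          refine le_trans ?_ hA
          have h1 : c ^ e ≤ c ^ a := pow_le_pow_of_le_one hc.le (by linarith [h.c_le]) hae
          have h2 : x ≤ x ^ (e + 1 - a) := le_self_pow₀ hx1 (by lia)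
          gcongr
        calc γ * c ^ e / 8 * (4 * n) = γ * x ^ e * (c ^ e / 2 * x) := by rw [← h.pow_eq]; ring
          _ ≤ q * A.card := mul_le_mul h.le_q hA' (by positivity) (by positivity)
      have := Real.exp_le_exp.2 (neg_le_neg key)
      rw [Nat.sub_self, pow_zero, one_mul]
      linarith
    · obtain ⟨v, hv⟩ := Finset.card_pos.1 (Nat.lt_of_succ_le hG'')
      obtain ⟨hvA, hvw⟩ := mem_joinedTo.1 hv
      refine ⟨v, fun hvZ => Finset.disjoint_left.1 hAZ hvA hvZ, fun u hu => ?_⟩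
      by_cases huw : u = w
      · exact huw ▸ hvw
      · exact toSimpleGraph_mono hle (hAT v hvA u (Finset.mem_erase.2 ⟨huw, hu⟩))

/-- The set of multigraphs that contain a copy of the subgraph of `F` induced by `s`. -/
def ContainsInduced {W : Type*} (F : SimpleGraph W) (s : Finset W) : Set (Multigraph n) :=
  {G | ∃ f : W → Fin n, Set.InjOn f s ∧
    ∀ x ∈ s, ∀ y ∈ s, F.Adj x y → (Multigraph.toSimpleGraph G).Adj (f x) (f y)}

/-- Degeneracy provides a vertex of `s` with at most `e + 1` neighbours in `s`; the rest is embedded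
first and this vertex is attached outside the image, which preserves injectivity. -/
theorem le_valueSet_containsInduced (hn : 2 ≤ n) {q e : ℕ} {x γ c : ℝ}
    (h : RoundParams n q e x γ c) {W : Type*} [Fintype W] {F : SimpleGraph W}
    (hF : IsDegenerate F (e + 1)) (hW : 2 * Fintype.card W ≤ n) (k : ℕ) (s : Finset W)
    (hs : s.card = k) (G : Multigraph n) :
    ENNReal.ofReal (attachProb e γ c ^ k) ≤
      valueSet (ContainsInduced F s) (k * ((e + 1) * q)) G := by
  classical
  induction k generalizing s G with
  | zero =>
    obtain rfl := Finset.card_eq_zero.1 hs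
    refine le_trans ?_ (one_le_valueSet hn ?_ _)
    · simp
    · exact fun G' _ => ⟨fun _ => 0, by simp, by simp⟩
  | succ k ih =>
    obtain ⟨v, hv, hvd⟩ := hF s (Finset.card_pos.1 (by lia))
    have hv : v ∈ s := hv
    have hp : 0 ≤ attachProb e γ c := (attachProb_pos (by linarith [h.c_pos, h.c_le']) h.c_pos).le
    rw [pow_succ, ENNReal.ofReal_mul (by positivity), Nat.succ_mul]
    refine mul_le_valueSet_add (ih (s.erase v) (by rw [Finset.card_erase_of_mem hv]; lia) G) ?_
    rintro G' ⟨f, hf, hadj⟩ -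
    let T := ((s.erase v).filter fun y => F.Adj v y).image f
    have hT : T.card ≤ e + 1 := by
      refine Finset.card_image_le.trans (le_trans ?_ hvd)
      rw [← Set.ncard_coe_finset]
      refine Set.ncard_le_ncard fun y hy => ?_
      obtain ⟨hy1, hy2⟩ := Finset.mem_filter.1 hy
      exact ⟨hy2, Finset.mem_of_mem_erase hy1⟩
    have hZ : 2 * ((s.erase v).image f).card ≤ n := by
      have h1 : ((s.erase v).image f).card ≤ (s.erase v).card := Finset.card_image_le
      have h2 : (s.erase v).card ≤ Fintype.card W := Finset.card_le_univ _
      lia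
    refine (le_valueSet_attach hn h hZ (Finset.image_subset_image (Finset.filter_subset _ _)) hT
      G').trans (valueSet_mono_left _ ?_)
    rintro G'' ⟨z, hz, hzT⟩ hle
    have hne : ∀ y ∈ s.erase v, f y ≠ z := fun y hy hyz =>
      hz (Finset.mem_image.2 ⟨y, hy, hyz⟩)
    refine ⟨Function.update f v z, ?_, ?_⟩
    · intro y hy y' hy' hyy
      by_cases h1 : y = v <;> by_cases h2 : y' = v
      · rw [h1, h2]
      · subst h1
        rw [Function.update_self, Function.update_of_ne h2] at hyy
        exact absurd hyy.symm (hne y' (Finset.mem_erase.2 ⟨h2, hy'⟩))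
      · subst h2
        rw [Function.update_self, Function.update_of_ne h1] at hyy
        exact absurd hyy (hne y (Finset.mem_erase.2 ⟨h1, hy⟩))
      · rw [Function.update_of_ne h1, Function.update_of_ne h2] at hyy
        exact hf (Finset.mem_erase.2 ⟨h1, hy⟩) (Finset.mem_erase.2 ⟨h2, hy'⟩) hyy
    · have hvz : ∀ y ∈ s, F.Adj v y → (Multigraph.toSimpleGraph G'').Adj (f y) z := fun y hy hvy =>
        hzT _ (Finset.mem_image_of_mem _ (Finset.mem_filter.2
          ⟨Finset.mem_erase.2 ⟨hvy.ne', hy⟩, hvy⟩))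
      intro y hy y' hy' hyy
      by_cases h1 : y = v <;> by_cases h2 : y' = v
      · exact absurd (h1.trans h2.symm) hyy.ne
      · subst h1
        rw [Function.update_self, Function.update_of_ne h2]
        exact (hvz y' hy' hyy).symm
      · subst h2
        rw [Function.update_self, Function.update_of_ne h1]
        exact hvz y hy hyy.symm
      · rw [Function.update_of_ne h1, Function.update_of_ne h2]
        exact toSimpleGraph_mono hle (hadj y (Finset.mem_erase.2 ⟨h1, hy⟩) y'
          (Finset.mem_erase.2 ⟨h2, hy'⟩) hyy)

end Build

/-! ### Choice of parameters for the second claim -/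

theorem exists_probAt_isContained_ge {W : Type*} [Finite W] [Nonempty W] {F : SimpleGraph W}
    {e : ℕ} (he : 1 ≤ e) (hF : IsDegenerate F (e + 1)) {β : ℝ} (hβ : 0 < β) :
    ∃ δ : ℝ, 0 < δ ∧ ∃ N : ℕ, ∀ (n : ℕ) [NeZero n], N ≤ n → ∃ S : Strategy n,
      δ ≤ probAt S (fun G => F.IsContained (Multigraph.toSimpleGraph G))
        ⌊β * (n : ℝ) ^ (((e + 1 : ℕ) - 1 : ℝ) / (e + 1 : ℕ))⌋₊ := by
  have := Fintype.ofFinite W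
  set k := Fintype.card W with hk
  have hk0 : 0 < k := Fintype.card_pos
  -- The number of rounds: `e + 1` for each of the `k` vertices. The factor 2 in `γ` absorbs the
  -- floor in `q`, as soon as `γ * x ^ e ≥ 1`.
  set L : ℕ := k * (e + 1) with hL
  have hL0 : (0 : ℝ) < L := by exact_mod_cast Nat.mul_pos hk0 e.succ_pos
  set γ : ℝ := β / (2 * L) with hγ
  have hγ0 : 0 < γ := by positivity
  set c : ℝ := min (1 / 4) (γ / 16) with hc
  have hc0 : 0 < c := lt_min (by norm_num) (by positivity)
  refine ⟨attachProb e γ c ^ k, pow_pos (attachProb_pos hγ0 hc0) k, ?_⟩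
  have hlim : Filter.Tendsto (fun n : ℕ => (n : ℝ) ^ (1 / (e + 1 : ℕ) : ℝ)) Filter.atTop
      Filter.atTop :=
    (tendsto_rpow_atTop (by positivity)).comp tendsto_natCast_atTop_atTop
  -- The bound `2 / c ^ e` yields `two_le`, `1 / γ` controls the floor, and `2 * k` keeps the image
  -- of the partial copy below half of the vertices.
  obtain ⟨N, hN⟩ := Filter.eventually_atTop.1 ((hlim.eventually_ge_atTop
    (max 1 (max (2 / c ^ e) (1 / γ)))).and (Filter.eventually_ge_atTop (max 2 (2 * k))))
  refine ⟨N, fun n _ hNn => ?_⟩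
  obtain ⟨hx, hn⟩ := hN n hNn
  set x : ℝ := (n : ℝ) ^ (1 / (e + 1 : ℕ) : ℝ) with hxdef
  have hx1 : 1 ≤ x := (le_max_left _ _).trans hx
  have hx2 : 2 / c ^ e ≤ x := ((le_max_left _ _).trans (le_max_right _ _)).trans hx
  have hx3 : 1 / γ ≤ x := ((le_max_right _ _).trans (le_max_right _ _)).trans hx
  have hn2 : 2 ≤ n := (le_max_left _ _).trans hn
  have hpow : (n : ℝ) ^ (((e + 1 : ℕ) - 1 : ℝ) / (e + 1 : ℕ)) = x ^ e := by
    rw [hxdef, ← Real.rpow_mul_natCast (by positivity)]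
    congr 1
    push_cast
    ring
  rw [hpow]
  set q : ℕ := ⌊β * x ^ e / L⌋₊ with hq
  have hparams : RoundParams n q e x γ c := by
    refine ⟨hx1, ?_, ?_, hc0, ?_, ?_, ?_⟩
    · rw [hxdef, ← Real.rpow_mul_natCast (by positivity), one_div_mul_cancel (by positivity),
        Real.rpow_one]
    · have h1 : β * x ^ e / L = 2 * (γ * x ^ e) := by
        rw [hγ]
        field_simp
      have h2 : 1 ≤ γ * x ^ e := by
        have : x ≤ x ^ e := le_self_pow₀ hx1 (by lia)
        rw [div_le_iff₀ hγ0] at hx3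
        nlinarith
      have h3 := Nat.lt_floor_add_one (β * x ^ e / L)
      rw [← hq] at h3
      linarith
    · linarith [min_le_left (1 / 4 : ℝ) (γ / 16)]
    · linarith [min_le_right (1 / 4 : ℝ) (γ / 16)]
    · rwa [div_le_iff₀' (by positivity)] at hx2
  have hsteps : k * ((e + 1) * q) ≤ ⌊β * x ^ e⌋₊ := by
    refine Nat.le_floor ?_
    have h1 : (q : ℝ) ≤ β * x ^ e / L := Nat.floor_le (by positivity)
    rw [le_div_iff₀ hL0, hL] at h1
    push_cast at h1 ⊢
    linarith
  obtain ⟨S, hS⟩ := exists_strategy_valueSet_le hn2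
    (fun G : Multigraph n => F.IsContained (Multigraph.toSimpleGraph G)) (k * ((e + 1) * q))
  refine ⟨S, le_trans ?_ (probAt_mono S
    (fun G G' h hG => hG.mono_right (toSimpleGraph_mono h)) hsteps)⟩
  refine (ENNReal.ofReal_le_ofReal_iff ENNReal.toReal_nonneg).1 (le_trans ?_ hS)
  refine (le_valueSet_containsInduced hn2 hparams hF ((le_max_right _ _).trans hn) k Finset.univ
    Finset.card_univ 0).trans (valueSet_mono_left _ ?_)
  rintro G ⟨f, hf, hadj⟩ -
  exact ⟨⟨⟨f, fun {x y} hxy => hadj x (Finset.mem_univ _) y (Finset.mem_univ _) hxy⟩,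
    fun x y hxy => hf (by simp) (by simp) hxy⟩⟩

end SemiRandom

/-! ### The three claims together -/

theorem mainTheorem6 {ι : Type*} [Finite ι] {V : ι → Type*} [∀ i, Finite (V i)]
    (H : ∀ i, SimpleGraph (V i)) (hH : ∀ i, ¬ (H i).IsAcyclic) (d : ℕ)
    (hd : IsLeast (Set.range fun i => SemiRandom.degeneracy (H i)) d) :
    (∃ α : ℝ, 0 < α ∧ ∀ (n : ℕ) [NeZero n] (S : SemiRandom.Strategy n),
      SemiRandom.probAt S (SemiRandom.ContainsSome H n)
        ⌊α * (n : ℝ) ^ (((d : ℝ) - 1) / (d : ℝ))⌋₊ ≤ 1 / 2) ∧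
    (∀ β : ℝ, 0 < β → ∃ δ : ℝ, 0 < δ ∧ ∃ N : ℕ, ∀ (n : ℕ) [NeZero n], N ≤ n →
      ∃ S : SemiRandom.Strategy n,
        δ ≤ SemiRandom.probAt S (SemiRandom.ContainsSome H n)
          ⌊β * (n : ℝ) ^ (((d : ℝ) - 1) / (d : ℝ))⌋₊) ∧
    (¬ ∃ st : ℕ → ℝ, SemiRandom.IsSharpThreshold (SemiRandom.ContainsSome H) st) := by
  obtain ⟨⟨i, hi⟩, hmin⟩ := hd
  have hi : SemiRandom.degeneracy (H i) = d := hi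
  have hd2 : 2 ≤ d := hi ▸ SemiRandom.two_le_degeneracy (hH i)
  obtain ⟨e, rfl⟩ : ∃ e, d = e + 1 := ⟨d - 1, by lia⟩
  have he : 1 ≤ e := by lia
  obtain ⟨s, hs⟩ := (Set.finite_range fun i => Nat.card (V i)).bddAbove
  have hlow : ∃ α : ℝ, 0 < α ∧ ∀ (n : ℕ) [NeZero n] (S : SemiRandom.Strategy n),
      SemiRandom.probAt S (SemiRandom.ContainsSome H n)
        ⌊α * (n : ℝ) ^ ((((e + 1 : ℕ) : ℝ) - 1) / ((e + 1 : ℕ) : ℝ))⌋₊ ≤ 1 / 2 :=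
    ⟨1 / (2 * (e + 1) ^ s), by positivity, fun n _ S => SemiRandom.probAt_containsSome_le_half he
      (fun j => Nat.lt_of_succ_le (hmin ⟨j, rfl⟩)) (fun j => hs ⟨j, rfl⟩) S⟩
  have hupp : ∀ β : ℝ, 0 < β → ∃ δ : ℝ, 0 < δ ∧ ∃ N : ℕ, ∀ (n : ℕ) [NeZero n], N ≤ n →
      ∃ S : SemiRandom.Strategy n, δ ≤ SemiRandom.probAt S (SemiRandom.ContainsSome H n)
        ⌊β * (n : ℝ) ^ ((((e + 1 : ℕ) : ℝ) - 1) / ((e + 1 : ℕ) : ℝ))⌋₊ := by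
    intro β hβ
    -- A graph without vertices would be acyclic.
    have : Nonempty (V i) := by
      by_contra hne
      rw [not_nonempty_iff] at hne
      exact hH i fun v => isEmptyElim v
    obtain ⟨δ, hδ, N, hN⟩ := SemiRandom.exists_probAt_isContained_ge he
      (hi ▸ SemiRandom.isDegenerate_degeneracy (H i)) hβ
    refine ⟨δ, hδ, N, fun n _ hn => ?_⟩
    obtain ⟨S, hS⟩ := hN n hn
    exact ⟨S, hS.trans (ENNReal.toReal_mono (SemiRandom.toOuterMeasure_ne_top _ _)
      (MeasureTheory.measure_mono fun l hl => ⟨i, hl⟩))⟩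
  exact ⟨hlow, hupp, fun ⟨st, hst⟩ => SemiRandom.not_isSharpThreshold
    (fun _ => SemiRandom.containsSome_mono) (SemiRandom.not_containsSome_zero hH) hlow hupp st hst⟩
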